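/- Let $n$ be an integer with $3\mid n$ and $n\not\equiv 12 \pmod{27}$. Let $L_n=\mathbb{Q}(\rho)$ be the simplest cubic field, where $\rho$ is a root of Shanks' cubic polynomial $f_n(X)=X^3-nX^2-(n+3)X-1$. Write $n^2+3n+9=de^2c^3$ with positive integers $d,e,c$ such that $d$ and $e$ are square-free and $\gcd(d,e)=1$. Let $\zeta$ be a primitive cube root of unity and put $A_n=n+3(1+\zeta)$. Let $a_0,a_1$ be integers such that $a_0+a_1\zeta$ divides $A_n$ in $\mathbb{Z}[\zeta]$ and $$ec=\begin{cases}a_0^2-a_0a_1+a_1^2 & \text{if } n\equiv 3 \pmod 9,\\ 3(a_0^2-a_0a_1+a_1^2) & \text{if } n\equiv 0,6 \pmod 9.\end{cases}$$ Then the Galois group $G=\mathrm{Gal}(L_n/\mathbb{Q})$ is generated by an automorphism $\sigma$ with $\sigma(\rho)=-1/(1+\rho)$, and, with $\rho'=\sigma(\rho)$, the element $$\alpha=\frac{1}{ec^2}\bigl(3a_0\rho+3a_1\rho'-n(a_0+a_1)\bigr)$$ satisfies $$\mathcal{O}_{L_n}=\mathbb{Z}[G].\alpha\oplus\mathbb{Z}=\mathcal{A}_{L_n/\mathbb{Q}}.(\alpha+1).$$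 Here $\mathcal{O}_{L_n}$ is the ring of integers of $L_n$, the group ring $\mathbb{Q}[G]$ acts on $L_n$ by $\bigl(\sum_{\tau\in G} q_\tau\tau\bigr).x=\sum_{\tau\in G} q_\tau\tau(x)$, and $\mathcal{A}_{L_n/\mathbb{Q}}=\{x\in\mathbb{Q}[G] : x.\mathcal{O}_{L_n}\subset\mathcal{O}_{L_n}\}$ is the associated order. -/

import Mathlib

open Polynomial

noncomputable section

/-- Shanks' cubic polynomial `X³ - n X² - (n + 3) X - 1`. -/
def shanksCubic (n : ℤ) : ℤ[X] :=
  X ^ 3 - C n * X ^ 2 - C (n + 3) * X - 1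

namespace GaloisModule

variable (K : Type*) [Field K] [NumberField K]

/-- The action of the group ring `ℚ[G]`, `G = Gal(K/ℚ)`, on `K`, as a ring homomorphism into the
`ℚ`-linear endomorphisms of `K`. It extends the action of `G`; see `act_apply`. -/
def act : MonoidAlgebra ℚ Gal(K/ℚ) →ₐ[ℚ] Module.End ℚ K :=
  MonoidAlgebra.lift ℚ (Module.End ℚ K) Gal(K/ℚ) (DistribMulAction.toModuleEnd ℚ K)

/-- `(∑ q_σ σ) . a = ∑ q_σ σ(a)`. -/
theorem act_apply (x : MonoidAlgebra ℚ Gal(K/ℚ)) (a : K) :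
    act K x a = ∑ σ : Gal(K/ℚ), x.coeff σ • σ a := by
  unfold act
  rw [MonoidAlgebra.lift_apply, Finsupp.sum_fintype _ _ (by simp)]
  simp

/-- The integral group ring `ℤ[G]`, as the subring of `ℚ[G]` of the elements with integer
coefficients. -/
def integralGroupRing : Subring (MonoidAlgebra ℚ Gal(K/ℚ)) :=
  (MonoidAlgebra.mapRingHom Gal(K/ℚ) (Int.castRingHom ℚ)).range

/-- The ring of integers of `K`, as an additive subgroup of `K`. -/
def integers : AddSubgroup K := (integralClosure ℤ K).toSubring.toAddSubgroup

/-- The associated order `{x ∈ ℚ[G] | x . 𝓞 ⊆ 𝓞}`, where `𝓞` is the ring of integers of `K`. -/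
def associatedOrder : Subring (MonoidAlgebra ℚ Gal(K/ℚ)) where
  carrier := {x | ∀ a ∈ integers K, act K x a ∈ integers K}
  mul_mem' := by
    intro x y hx hy a ha
    simpa using hx _ (hy a ha)
  one_mem' := by
    intro a ha
    simpa using ha
  add_mem' := by
    intro x y hx hy a ha
    simpa using add_mem (hx a ha) (hy a ha)
  zero_mem' := by
    intro a _
    simp
  neg_mem' := by
    intro x hx a ha
    simpa using hx a ha

variable {K}

/-- For a subring `A` of `ℚ[G]` and `a ∈ K`, the additive group `A . a = {x . a | x ∈ A}`. -/
def cyclicModule (A : Subring (MonoidAlgebra ℚ Gal(K/ℚ))) (a : K) : AddSubgroup K :=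
  A.toAddSubgroup.map ((LinearMap.applyₗ a).toAddMonoidHom.comp (act K).toLinearMap.toAddMonoidHom)

theorem mem_cyclicModule (A : Subring (MonoidAlgebra ℚ Gal(K/ℚ))) (a b : K) :
    b ∈ cyclicModule A a ↔ ∃ x ∈ A, act K x a = b := Iff.rfl

end GaloisModule

/-- The element `ζ` of the ring `ℤ[ζ] ⊆ ℂ`. -/
def adjoinGen (ζ : ℂ) : Algebra.adjoin ℤ {ζ} :=
  ⟨ζ, Algebra.self_mem_adjoin_singleton ℤ ζ⟩

end

/-!
The field `K` is cyclic cubic, and `α` has trace zero. On the elements of trace zero `σ` acts as a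
primitive cube root of unity, so `ℤ[G] . α` is spanned by `α` and `σ(α)`. Everything rests on the
characteristic polynomial `X³ - 3 P X - q` of `α`. Writing `n = 3 m`, the element is
`3 (a₀ (ρ - m) + a₁ (σ(ρ) - m)) / (e c²)`, and the cube of its Lagrange resolvent is, up to rational
factors, `(a₀ + a₁ ζ̄)³ (m + 1 + ζ)`. The divisibility hypothesis says that the norm of `a₀ + a₁ ζ`
divides `3 (a₀ - a₁ (m + 1))` (`norm_dvd_of_dvd_adjoin`). From this it follows that `P` and `q` are
integers, that `P` is the product of the primes other than `3` dividing `d e`, that `P ∣ q`, and,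
as `n ≢ 12` modulo `27`, that `27 ∤ 4 P³ - q²` (`exists_params_of_modEq_one`,
`exists_params_of_not_modEq_one`).

These properties alone imply the theorem, without a computation of the discriminant of `K`. Since
`P ∣ α³`, the traces of `α x` and `σ(α) x` are divisible by `P` for every integer `x`
(`dvd_trace_mul`); since the trace form is explicit on `α`, `σ(α)`, this gives
`3 x - Tr x = i α + j σ(α)` with integers `i`, `j`
(`IsTraceZeroGenerator.exists_three_mul_eq`). If some trace were prime to `3`, inverting
`i + j σ` modulo `3` would make `α` congruent to a rational integer modulo `3`, which the condition
on `4 P³ - q²` excludes (`IsTraceZeroGenerator.three_dvd_trace`). So all traces are divisible by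
`3`; applied to `x` and `x²` this forces `3 ∣ i, j`, and `x` is in the span of `α`, `σ(α)` and `1`
(`IsTraceZeroGenerator.exists_eq`). The statement on the associated order follows, because the
idempotent `(1 + σ + σ²) / 3` then belongs to it.
-/

/-! ### Arithmetic of the decomposition `n² + 3n + 9 = d e² c³` -/

/-- Divisibility by `a₀ + a₁ ζ` in `ℤ[ζ]`, read off in coordinates: the norm of `a₀ + a₁ ζ` divides
the `ζ`-coordinate of the conjugate of `a₀ + a₁ ζ` times `n + 3 (1 + ζ)`. -/
theorem norm_dvd_of_dvd_adjoin {ζ : ℂ} (hζ : IsPrimitiveRoot ζ 3) {n a₀ a₁ : ℤ}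
    (hdvd : (a₀ : Algebra.adjoin ℤ {ζ}) + (a₁ : Algebra.adjoin ℤ {ζ}) * adjoinGen ζ ∣
      (n : Algebra.adjoin ℤ {ζ}) + 3 * (1 + adjoinGen ζ)) :
    a₀ ^ 2 - a₀ * a₁ + a₁ ^ 2 ∣ 3 * a₀ - (n + 3) * a₁ := by
  have hζ2 : ζ ^ 2 + ζ + 1 = 0 := by
    have h1 : ζ ^ 3 = 1 := hζ.pow_eq_one
    have h2 : ζ - 1 ≠ 0 := sub_ne_zero.mpr (hζ.ne_one (by norm_num))
    refine mul_left_cancel₀ h2 ?_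
    linear_combination h1
  have hrep : ∀ z ∈ Algebra.adjoin ℤ {ζ}, ∃ x y : ℤ, z = x + y * ζ := by
    intro z hz
    induction hz using Algebra.adjoin_induction with
    | mem z hz =>
      rw [Set.mem_singleton_iff] at hz
      exact ⟨0, 1, by simp [hz]⟩
    | algebraMap r => exact ⟨r, 0, by simp⟩
    | add _ _ _ _ h1 h2 =>
      obtain ⟨x, y, rfl⟩ := h1
      obtain ⟨x', y', rfl⟩ := h2
      exact ⟨x + x', y + y', by push_cast; ring⟩
    | mul _ _ _ _ h1 h2 =>
      obtain ⟨x, y, rfl⟩ := h1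
      obtain ⟨x', y', rfl⟩ := h2
      refine ⟨x * x' - y * y', x * y' + y * x' - y * y', ?_⟩
      push_cast
      linear_combination (y * y' : ℂ) * hζ2
  have hind : ∀ x y : ℤ, (x : ℂ) + y * ζ = 0 → x = 0 ∧ y = 0 := by
    intro x y h
    have h1 : ((x ^ 2 - x * y + y ^ 2 : ℤ) : ℂ) = 0 := by
      push_cast
      linear_combination (x - y - y * ζ : ℂ) * h + (y ^ 2 : ℂ) * hζ2
    have h2 : x ^ 2 - x * y + y ^ 2 = 0 := by exact_mod_cast h1
    constructor <;> nlinarith [sq_nonneg (x - y), sq_nonneg x, sq_nonneg y, sq_nonneg (x + y)]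
  obtain ⟨⟨b, hb⟩, hab⟩ := hdvd
  obtain ⟨b₀, b₁, rfl⟩ := hrep b hb
  have hab' := congrArg Subtype.val hab
  simp only [adjoinGen] at hab'
  push_cast at hab'
  have h3 : ((3 : Algebra.adjoin ℤ {ζ}) : ℂ) = 3 := rfl
  rw [h3] at hab'
  obtain ⟨h0, h1⟩ := hind (n + 3 - (a₀ * b₀ - a₁ * b₁)) (3 - (a₀ * b₁ + a₁ * b₀ - a₁ * b₁)) (by
    push_cast
    linear_combination hab' + (a₁ * b₁ : ℂ) * hζ2)
  exact ⟨b₁, by linear_combination a₀ * h1 - a₁ * h0⟩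

/-- The identity `4 z z̄ = (z + z̄)² + 3 b²` for `z = (a₀ + a₁ ζ̄)³ (m + 1 + ζ)` and `b` its
`ζ`-coordinate. -/
theorem four_mul_norm_eq (m a₀ a₁ t : ℤ) (ht : t = a₀ - a₁ * (m + 1)) :
    4 * (a₀ ^ 2 - a₀ * a₁ + a₁ ^ 2) ^ 3 * (m ^ 2 + m + 1) =
      ((2 * m + 1) * t ^ 3 + 6 * t ^ 2 * a₁ * (m ^ 2 + m + 1) +
        3 * t * a₁ ^ 2 * (m ^ 2 + m + 1) * (2 * m + 1) +
        a₁ ^ 3 * (m ^ 2 + m + 1) * (2 * m ^ 2 + 2 * m - 1)) ^ 2 +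
      3 * (a₀ ^ 3 - 3 * a₀ ^ 2 * a₁ + a₁ ^ 3 + 3 * m * a₀ * a₁ * (a₁ - a₀)) ^ 2 := by
  subst ht; ring

theorem Int.three_not_dvd_sq_add {m : ℤ} (hm : ¬ m ≡ 1 [ZMOD 3]) : ¬ 3 ∣ m ^ 2 + m + 1 := by
  obtain ⟨k, hk⟩ : ∃ k, m = 3 * k ∨ m = 3 * k + 1 ∨ m = 3 * k + 2 := ⟨m / 3, by omega⟩
  rcases hk with rfl | rfl | rfl
  · rintro ⟨l, hl⟩; ring_nf at hl; omega
  · exact absurd (by unfold Int.ModEq; omega) hm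
  · rintro ⟨l, hl⟩; ring_nf at hl; omega

theorem Int.not_nine_dvd_of_squarefree {e x : ℤ} (he : Squarefree e) (h : e = 9 * x) : False := by
  have := he 3 ⟨x, by linarith⟩
  rw [Int.isUnit_iff] at this
  omega

/-- If `9 ∥ n² + 3n + 9`, the factor `3` occurs in `e` only. -/
theorem three_dvd_e {N d e c : ℤ} (hN : ¬ 3 ∣ N) (hd : Squarefree d)
    (hΔ : 9 * N = d * e ^ 2 * c ^ 3) :
    ∃ e', e = 3 * e' ∧ N = d * e' ^ 2 * c ^ 3 := by
  have hp := Int.prime_three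
  have hc : ¬ 3 ∣ c := by
    rintro ⟨c', rfl⟩
    exact hN ⟨d * e ^ 2 * c' ^ 3, by linarith⟩
  have he : 3 ∣ e := by
    by_contra he
    have h9 : (3 : ℤ) ^ 2 ∣ d := by
      have h1 : (3 : ℤ) ^ 2 ∣ c ^ 3 * (e ^ 2 * d) := ⟨N, by linarith⟩
      refine hp.pow_dvd_of_dvd_mul_left 2 ?_ (hp.pow_dvd_of_dvd_mul_left 2 ?_ h1)
      · exact fun h => he (hp.dvd_of_dvd_pow h)
      · exact fun h => hc (hp.dvd_of_dvd_pow h)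
    obtain ⟨x, hx⟩ := h9
    exact Int.not_nine_dvd_of_squarefree hd (by linarith)
  obtain ⟨e', rfl⟩ := he
  exact ⟨e', rfl, by linarith⟩

/-- If `27 ∥ n² + 3n + 9`, the factor `3` occurs in `c` only. -/
theorem three_dvd_c {N d e c : ℤ} (hd : Squarefree d) (he : Squarefree e)
    (hde : IsCoprime d e) (hΔ : 27 * N = d * e ^ 2 * c ^ 3) :
    ∃ c', c = 3 * c' ∧ N = d * e ^ 2 * c' ^ 3 := by
  have hp := Int.prime_three
  have hc : 3 ∣ c := by
    by_contra hc
    have h1 : (3 : ℤ) ^ 3 ∣ d * e ^ 2 := by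
      refine hp.pow_dvd_of_dvd_mul_right 3 (b := c ^ 3) (fun h => hc (hp.dvd_of_dvd_pow h)) ?_
      exact ⟨N, by linarith⟩
    by_cases h3 : 3 ∣ e
    · obtain ⟨e', rfl⟩ := h3
      obtain ⟨x, hx⟩ := h1
      have h3d : 3 ∣ d * e' ^ 2 := ⟨x, by linarith⟩
      rcases hp.dvd_or_dvd h3d with h | h
      · exact hp.not_isUnit (hde.isUnit_of_dvd' h ⟨e', rfl⟩)
      · obtain ⟨y, rfl⟩ := hp.dvd_of_dvd_pow h
        exact Int.not_nine_dvd_of_squarefree he (x := y) (by ring)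
    · have h2 := hp.pow_dvd_of_dvd_mul_right 3 (fun h => h3 (hp.dvd_of_dvd_pow h)) h1
      obtain ⟨x, hx⟩ := h2
      exact Int.not_nine_dvd_of_squarefree hd (x := 3 * x) (by linarith)
  obtain ⟨c', rfl⟩ := hc
  exact ⟨c', rfl, by linarith⟩

/-- The integers `P`, `q` are the invariants of `α = 3 (a₀ (ρ - m) + a₁ (ρ' - m)) / w`, for `ρ` a
root of Shanks' cubic of parameter `3 m` and `ρ' = -1 / (1 + ρ)`: the characteristic polynomial of
`α` is `X³ - 3 P X - q`, as the equations `form` and `norm` say after multiplication by powers of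
`w`. Moreover `P` is square-free, prime to `3` and divides `q`, and `27 ∤ 4 P³ - q²`. -/
structure IsCubicParams (m a₀ a₁ w P q : ℤ) : Prop where
  squarefree : Squarefree P
  not_three_dvd : ¬ 3 ∣ P
  dvd : P ∣ q
  not_dvd : ¬ 27 ∣ 4 * P ^ 3 - q ^ 2
  form : 9 * (a₀ ^ 2 - a₀ * a₁ + a₁ ^ 2) * (m ^ 2 + m + 1) = P * w ^ 2
  norm : 27 * (m ^ 2 + m + 1) * ((2 * m + 1) * (a₀ - a₁ * (m + 1)) ^ 3 +
    6 * (a₀ - a₁ * (m + 1)) ^ 2 * a₁ * (m ^ 2 + m + 1) +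
    3 * (a₀ - a₁ * (m + 1)) * a₁ ^ 2 * (m ^ 2 + m + 1) * (2 * m + 1) +
    a₁ ^ 3 * (m ^ 2 + m + 1) * (2 * m ^ 2 + 2 * m - 1)) = q * w ^ 3

/-- The invariants for `9 ∥ n² + 3n + 9`: here `P = d e / 3`, and the congruence of
`a₀ - a₁ (m + 1)` modulo the norm of `a₀ + a₁ ζ` makes `q` an integer divisible by `P`. -/
theorem exists_params_of_not_modEq_one {m d e c a₀ a₁ : ℤ} (hm : ¬ m ≡ 1 [ZMOD 3])
    (hd : Squarefree d) (he : Squarefree e) (hde : IsCoprime d e)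
    (hΔ : 9 * (m ^ 2 + m + 1) = d * e ^ 2 * c ^ 3)
    (ha : e * c = 3 * (a₀ ^ 2 - a₀ * a₁ + a₁ ^ 2))
    (hdvd : a₀ ^ 2 - a₀ * a₁ + a₁ ^ 2 ∣ 3 * (a₀ - a₁ * (m + 1))) :
    ∃ P q : ℤ, IsCubicParams m a₀ a₁ (e * c ^ 2) P q := by
  have hp := Int.prime_three
  have hN := Int.three_not_dvd_sq_add hm
  have hid := four_mul_norm_eq m a₀ a₁ _ rfl
  obtain ⟨e', rfl, hΔ'⟩ := three_dvd_e hN hd hΔ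
  have hec : a₀ ^ 2 - a₀ * a₁ + a₁ ^ 2 = e' * c := by linarith
  have h3N : ¬ 3 ∣ d * e' ^ 2 * c ^ 3 := hΔ' ▸ hN
  have h3d : ¬ 3 ∣ d := fun h => h3N ((h.mul_right _).mul_right _)
  have h3e : ¬ 3 ∣ e' := fun h => h3N (((h.pow two_ne_zero).mul_left _).mul_right _)
  have h3c : ¬ 3 ∣ c := fun h => h3N ((h.pow three_ne_zero).mul_left _)
  rw [hec] at hdvd
  have h3ec : IsCoprime (e' * c) 3 :=
    ((Prime.coprime_iff_not_dvd hp).2 (fun h => (hp.dvd_or_dvd h).elim h3e h3c)).symm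
  obtain ⟨t, ht⟩ := h3ec.dvd_of_dvd_mul_left hdvd
  -- `4 P³ - q²` is `3 d² H²` divided by a square, with `d` and `H` prime to `3`
  have hH : ¬ 3 ∣ a₀ ^ 3 - 3 * a₀ ^ 2 * a₁ + a₁ ^ 3 + 3 * m * a₀ * a₁ * (a₁ - a₀) := by
    rintro ⟨k, hk⟩
    have h1 : 3 ∣ (a₀ + a₁) ^ 3 := ⟨k + 2 * a₀ ^ 2 * a₁ + a₀ * a₁ ^ 2 -
      m * a₀ * a₁ * (a₁ - a₀), by linear_combination hk⟩
    obtain ⟨l, hl⟩ := hp.dvd_of_dvd_pow h1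
    have : 3 ∣ e' * c := ⟨3 * l ^ 2 - a₀ * a₁, by
      linear_combination -hec + (a₀ + a₁ + 3 * l) * hl⟩
    exact (hp.dvd_or_dvd this).elim h3e h3c
  generalize a₀ ^ 3 - 3 * a₀ ^ 2 * a₁ + a₁ ^ 3 + 3 * m * a₀ * a₁ * (a₁ - a₀) = H at hH hid
  rw [ht, hec, hΔ'] at hid
  refine ⟨d * e', d * e' * ((2 * m + 1) * e' * t ^ 3 + 6 * t ^ 2 * a₁ * d * (e' * c) ^ 2 +
    3 * t * a₁ ^ 2 * d * e' * c * (2 * m + 1) + a₁ ^ 3 * d * (2 * m ^ 2 + 2 * m - 1)),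
    ?_, ?_, ⟨_, rfl⟩, ?_, by rw [hec, hΔ']; ring,
    by rw [ht, hΔ']; ring⟩
  · exact (squarefree_mul_iff.2 ⟨(hde.of_isCoprime_of_dvd_right ⟨3, by ring⟩).isRelPrime, hd,
      he.squarefree_of_dvd ⟨3, by ring⟩⟩)
  · exact fun h => (hp.dvd_or_dvd h).elim h3d h3e
  · rintro ⟨k, hk⟩
    have h1 : 3 ∣ (d * H) ^ 2 := ⟨3 * e' ^ 2 * c ^ 6 * k, mul_left_cancel₀ three_ne_zero (by
      linear_combination e' ^ 2 * c ^ 6 * hk - d ^ 2 * hid)⟩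
    exact (hp.dvd_or_dvd (hp.dvd_of_dvd_pow h1)).elim h3d hH

/-- The invariants for `27 ∥ n² + 3n + 9`: here `P = d e`. -/
theorem exists_params_of_modEq_one {m d e c a₀ a₁ : ℤ} (hm : m ≡ 1 [ZMOD 3])
    (hm4 : ¬ m ≡ 4 [ZMOD 9])
    (hd : Squarefree d) (he : Squarefree e) (hde : IsCoprime d e)
    (hΔ : 9 * (m ^ 2 + m + 1) = d * e ^ 2 * c ^ 3)
    (ha : e * c = a₀ ^ 2 - a₀ * a₁ + a₁ ^ 2)
    (hdvd : a₀ ^ 2 - a₀ * a₁ + a₁ ^ 2 ∣ 3 * (a₀ - a₁ * (m + 1))) :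
    ∃ P q : ℤ, IsCubicParams m a₀ a₁ (e * c ^ 2) P q := by
  have hp := Int.prime_three
  have hid := four_mul_norm_eq m a₀ a₁ _ rfl
  obtain ⟨l, hl⟩ : ∃ l, m = 3 * l + 1 := ⟨m / 3, by unfold Int.ModEq at hm; omega⟩
  have hl1 : ¬ 3 ∣ 2 * l + 1 := by unfold Int.ModEq at hm4; omega
  have hN : ¬ 3 ∣ 3 * l ^ 2 + 3 * l + 1 := by
    rintro ⟨x, hx⟩; omega
  obtain ⟨c', rfl, hΔ'⟩ := three_dvd_c (N := 3 * l ^ 2 + 3 * l + 1) (d := d) (e := e) (c := c)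
    hd he hde (by rw [← hΔ, hl]; ring)
  have hNm : m ^ 2 + m + 1 = 3 * (d * e ^ 2 * c' ^ 3) := by rw [← hΔ', hl]; ring
  have h3N : ¬ 3 ∣ d * e ^ 2 * c' ^ 3 := hΔ' ▸ hN
  have h3d : ¬ 3 ∣ d := fun h => h3N ((h.mul_right _).mul_right _)
  have h3e : ¬ 3 ∣ e := fun h => h3N (((h.pow two_ne_zero).mul_left _).mul_right _)
  have h3c : ¬ 3 ∣ c' := fun h => h3N ((h.pow three_ne_zero).mul_left _)
  have h3ec' : ¬ 3 ∣ e * c' := fun h => (hp.dvd_or_dvd h).elim h3e h3c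
  rw [← ha] at hdvd
  have h3ec : IsCoprime (e * c') 3 := ((Prime.coprime_iff_not_dvd hp).2 h3ec').symm
  obtain ⟨k, hk⟩ : 3 ∣ a₀ + a₁ := hp.dvd_of_dvd_pow (n := 2)
    ⟨e * c' + a₀ * a₁, by linear_combination -ha⟩
  have h3a₁ : ¬ 3 ∣ a₁ := by
    rintro ⟨x, hx⟩
    refine h3ec' ⟨k ^ 2 - a₀ * x, mul_left_cancel₀ three_ne_zero ?_⟩
    linear_combination ha + (a₀ + a₁ + 3 * k) * hk - 3 * a₀ * hx
  have h3a₀ : ¬ 3 ∣ a₀ := by omega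
  obtain ⟨t, ht⟩ : e * c' * 3 ∣ a₀ - a₁ * (m + 1) := by
    refine h3ec.mul_dvd ?_ ⟨k - a₁ * (l + 1), by rw [hl]; linear_combination hk⟩
    obtain ⟨x, hx⟩ := hdvd
    exact ⟨x, mul_left_cancel₀ three_ne_zero (by linear_combination hx)⟩
  -- `4 P³ - q²` is `27 d² H²` divided by the square of `e c³ = 27 e c'³`, so `27 ∣ 4 P³ - q²`
  -- would give `27 ∣ H`; but `9 ∥ H` because `m ≢ 4` modulo `9`
  have hH : ¬ 27 ∣ a₀ ^ 3 - 3 * a₀ ^ 2 * a₁ + a₁ ^ 3 + 3 * m * a₀ * a₁ * (a₁ - a₀) := by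
    rintro ⟨x, hx⟩
    have h1 : 3 ∣ a₀ * a₁ ^ 2 * (2 * l + 1) := by
      refine ⟨x - k ^ 3 + a₀ * a₁ * k * (1 + l), 
        mul_left_cancel₀ (a := 9) (by norm_num) ?_⟩
      obtain rfl : a₀ = 3 * k - a₁ := by omega
      subst hl
      linear_combination hx
    refine (hp.dvd_or_dvd h1).elim (fun h => ?_) hl1
    exact (hp.dvd_or_dvd h).elim h3a₀ (fun h => h3a₁ (hp.dvd_of_dvd_pow h))
  generalize a₀ ^ 3 - 3 * a₀ ^ 2 * a₁ + a₁ ^ 3 + 3 * m * a₀ * a₁ * (a₁ - a₀) = H at hH hid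
  obtain ⟨w, hw⟩ : ∃ w, 2 * m ^ 2 + 2 * m - 1 = 3 * w :=
    ⟨6 * l ^ 2 + 6 * l + 1, by rw [hl]; ring⟩
  rw [ht, hw, ← ha, hNm] at hid
  refine ⟨d * e, d * e * (3 * (2 * m + 1) * e * t ^ 3 + 2 * (3 * e * c' * t) ^ 2 * a₁ * d +
    3 * e * c' * t * a₁ ^ 2 * (2 * m + 1) * d + d * a₁ ^ 3 * w),
    ?_, ?_, ⟨_, rfl⟩, ?_, by rw [← ha, hNm]; ring,
    by rw [ht, hw, hNm]; ring⟩
  · exact squarefree_mul_iff.2 ⟨hde.isRelPrime, hd, he⟩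
  · exact fun h => (hp.dvd_or_dvd h).elim h3d h3e
  · rintro ⟨y, hy⟩
    have h1 : (27 * (e * c' ^ 3)) ^ 2 ∣ (d * H) ^ 2 :=
      ⟨y, mul_left_cancel₀ (a := 27) (by norm_num) (by
        linear_combination 729 * e ^ 2 * c' ^ 6 * hy - 9 * d ^ 2 * hid)⟩
    rw [Int.pow_dvd_pow_iff two_ne_zero] at h1
    have h2 : (3 : ℤ) ^ 3 ∣ d * H := (Dvd.intro _ rfl).trans h1
    exact hH (hp.pow_dvd_of_dvd_mul_left 3 h3d h2)

/-! ### Integers of a cyclic cubic field generated by an element of trace zero -/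

section CyclicCubic

variable {K : Type*} [Field K] [NumberField K]

theorem IsIntegral.apply_gal {x : K} (hx : IsIntegral ℤ x) (σ : Gal(K/ℚ)) :
    IsIntegral ℤ (σ x) :=
  hx.map (σ.toAlgHom.restrictScalars ℤ)

theorem exists_int_of_isIntegral_of_rat {q : ℚ} (h : IsIntegral ℤ (q : K)) :
    ∃ k : ℤ, (q : K) = k := by
  have h' : IsIntegral ℤ q :=
    (isIntegral_algHom_iff ((Algebra.ofId ℚ K).restrictScalars ℤ) (algebraMap ℚ K).injective).1
      (by simpa [Algebra.ofId_apply] using h)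
  obtain ⟨k, hk⟩ := IsIntegrallyClosed.isIntegral_iff.1 h'
  exact ⟨k, by rw [← hk]; simp⟩

/-- If a non-zero integer multiple of an algebraic integer is a rational integer, the quotient is
a rational integer too. -/
theorem dvd_of_mul_isIntegral {a b : ℤ} (ha : a ≠ 0) {y : K} (hy : IsIntegral ℤ y)
    (h : (b : K) = a * y) : a ∣ b := by
  have ha' : (a : K) ≠ 0 := by exact_mod_cast ha
  have hq : y = ((b / a : ℚ) : K) := by
    push_cast; rw [eq_div_iff ha', h]; ring
  obtain ⟨k, hk⟩ := exists_int_of_isIntegral_of_rat (hq ▸ hy)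
  refine ⟨k, ?_⟩
  rw [hq, hk] at h
  exact_mod_cast h

/-- `σ` acts with `σ³ = 1`, and the sums over its orbits are the traces. For a cyclic cubic field
this holds for either generator of the Galois group. -/
structure IsCubicGenerator (σ : Gal(K/ℚ)) : Prop where
  apply_three : ∀ x, σ (σ (σ x)) = x
  trace_eq : ∀ x, algebraMap ℚ K (Algebra.trace ℚ K x) = x + σ x + σ (σ x)

theorem IsCubicGenerator.trace_int {σ : Gal(K/ℚ)} (hσ : IsCubicGenerator σ) {x : K}
    (hx : IsIntegral ℤ x) : ∃ k : ℤ, x + σ x + σ (σ x) = k := by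
  have h : IsIntegral ℤ (algebraMap ℚ K (Algebra.trace ℚ K x)) := by
    rw [hσ.trace_eq]
    exact (hx.add (hx.apply_gal σ)).add ((hx.apply_gal σ).apply_gal σ)
  obtain ⟨k, hk⟩ := exists_int_of_isIntegral_of_rat h
  exact ⟨k, by rw [← hσ.trace_eq]; exact hk⟩

/-- An integer `α` with `α³ ∈ P 𝓞`, `P` square-free, is nilpotent modulo `P`, and so are the
conjugates of its multiples; hence their traces are divisible by `P`. -/
theorem dvd_trace_mul {σ : Gal(K/ℚ)} (hσ : IsCubicGenerator σ) {α : K} (hα : IsIntegral ℤ α)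
    {P : ℤ} (hP : Squarefree P) {β : K} (hβ : IsIntegral ℤ β) (h : α ^ 3 = P * β)
    {x : K} (hx : IsIntegral ℤ x) :
    ∃ k : ℤ, α * x + σ (α * x) + σ (σ (α * x)) = P * k := by
  obtain ⟨k, hk⟩ := hσ.trace_int (hα.mul hx)
  suffices hd : P ∣ k by
    obtain ⟨l, rfl⟩ := hd
    exact ⟨l, by rw [hk]; push_cast; ring⟩
  let I : Ideal (integralClosure ℤ K) := Ideal.span {(P : integralClosure ℤ K)}
  have key : ∀ z b : K, ∀ hz : IsIntegral ℤ z, IsIntegral ℤ b → z ^ 3 = P * b →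
      (⟨z, hz⟩ : integralClosure ℤ K) ∈ I.radical := by
    intro z b hz hb hzb
    refine ⟨3, Ideal.mem_span_singleton.2 ⟨⟨b, hb⟩, Subtype.ext ?_⟩⟩
    simpa using hzb
  have hy := hα.mul hx
  have hb := hβ.mul (hx.pow 3)
  have h0 : (α * x) ^ 3 = P * (β * x ^ 3) := by rw [mul_pow, h]; ring
  have h1 : (σ (α * x)) ^ 3 = P * σ (β * x ^ 3) := by rw [← map_pow, h0, map_mul, map_intCast]
  have h2 : (σ (σ (α * x))) ^ 3 = P * σ (σ (β * x ^ 3)) := by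
    rw [← map_pow, h1, map_mul, map_intCast]
  obtain ⟨r, hr⟩ := I.radical.add_mem (I.radical.add_mem (key _ _ hy hb h0)
    (key _ _ (hy.apply_gal σ) (hb.apply_gal σ) h1))
    (key _ _ ((hy.apply_gal σ).apply_gal σ) ((hb.apply_gal σ).apply_gal σ) h2)
  obtain ⟨⟨w, hw⟩, hw'⟩ := Ideal.mem_span_singleton.1 hr
  have hw'' : ((k ^ r : ℤ) : K) = P * w := by
    have := congrArg Subtype.val hw'
    push_cast at this ⊢
    rw [← hk]
    exact this
  have h3 : P ∣ k ^ r := dvd_of_mul_isIntegral hP.ne_zero hw hw''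
  exact (hP.dvd_pow_iff_dvd (Nat.succ_ne_zero r)).1 (h3.trans (pow_dvd_pow k r.le_succ))

/-- An integer `α` of trace zero with characteristic polynomial `X³ - 3 P X - q`, where `P` is
square-free, prime to `3` and divides `q`, and where `27 ∤ 4 P³ - q²`. The last condition
prevents `α` from being congruent modulo `3` to a rational integer prime to `3`. -/
structure IsTraceZeroGenerator (σ : Gal(K/ℚ)) (α : K) (P q : ℤ) : Prop where
  isIntegral : IsIntegral ℤ α
  trace : α + σ α + σ (σ α) = 0
  norm : α * σ α * σ (σ α) = q
  form : α ^ 2 + α * σ α + σ α ^ 2 = 3 * P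
  squarefree : Squarefree P
  not_three_dvd : ¬ 3 ∣ P
  dvd : P ∣ q
  not_dvd : ¬ 27 ∣ 4 * P ^ 3 - q ^ 2

namespace IsTraceZeroGenerator

variable {σ : Gal(K/ℚ)} {α : K} {P q : ℤ}

theorem pow_three_eq (hα : IsTraceZeroGenerator σ α P q) : α ^ 3 = 3 * P * α + q := by
  linear_combination α * hα.form + hα.norm - α * σ α * hα.trace

/-- The integers `x` satisfy `3 x = Tr x + i α + j σ(α)` with integers `i`, `j`: the traces of
`α x` and `σ(α) x`, which determine `3 x - Tr x`, are divisible by `P`, and the trace form on the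
lattice spanned by `α` and `σ(α)` has discriminant `27 P²`. The last equation computes
`Tr ((3 x - Tr x)²)` in two ways. -/
theorem exists_three_mul_eq (hσ : IsCubicGenerator σ) (hα : IsTraceZeroGenerator σ α P q)
    {x : K} (hx : IsIntegral ℤ x) :
    ∃ τ i j S : ℤ, x + σ x + σ (σ x) = τ ∧ 3 * x - τ = i * α + j * σ α ∧
      2 * P * (i ^ 2 - i * j + j ^ 2) = 3 * S - τ ^ 2 ∧
      x ^ 2 + σ x ^ 2 + σ (σ x) ^ 2 = S := by
  have hp := Int.prime_three
  obtain ⟨h, hh⟩ := hα.dvd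
  have hcube : α ^ 3 = P * (3 * α + h) := by
    rw [hα.pow_three_eq, hh]; push_cast; ring
  have hint3 : IsIntegral ℤ (3 * α + h : K) :=
    by
    simpa using ((isIntegral_intCast 3).mul hα.isIntegral).add (isIntegral_intCast h)
  have hcube' : σ α ^ 3 = P * σ (3 * α + h) := by
    rw [← map_pow, hcube, map_mul, map_intCast]
  obtain ⟨k₁, hk₁⟩ := dvd_trace_mul hσ hα.isIntegral hα.squarefree hint3 hcube hx
  obtain ⟨k₂, hk₂⟩ := dvd_trace_mul hσ (hα.isIntegral.apply_gal σ) hα.squarefree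
    (hint3.apply_gal σ) hcube' hx
  obtain ⟨τ, hτ⟩ := hσ.trace_int hx
  obtain ⟨S, hS⟩ := hσ.trace_int (hx.pow 2)
  have htr := hα.trace
  have hform := hα.form
  have hP : (P : K) ≠ 0 := by exact_mod_cast hα.squarefree.ne_zero
  simp only [map_mul, map_pow, hσ.apply_three] at hk₁ hk₂ hS
  have hα2 : σ (σ α) = -α - σ α := by linear_combination htr
  have hx2 : σ (σ x) = τ - x - σ x := by linear_combination hτ
  have key : 3 * (3 * x - τ) = (2 * k₁ + k₂) * α + (k₁ + 2 * k₂) * σ α := by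
    refine mul_left_cancel₀ hP ?_
    rw [hα2, hx2] at hk₁ hk₂
    linear_combination (2 * α + σ α) * hk₁ + (α + 2 * σ α) * hk₂ - (3 * x - τ) * hform
  have key' : 3 * (3 * σ x - τ) = (2 * k₁ + k₂) * σ α + (k₁ + 2 * k₂) * σ (σ α) := by
    simpa only [map_mul, map_add, map_sub, map_ofNat, map_intCast] using congrArg σ key
  have hM : 2 * P * (k₁ ^ 2 + k₁ * k₂ + k₂ ^ 2) = 9 * S - 3 * τ ^ 2 := by
    rw [hα2] at key'
    have h1 : (9 : K) * (2 * P * (k₁ ^ 2 + k₁ * k₂ + k₂ ^ 2)) = 9 * (9 * S - 3 * τ ^ 2) := by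
      rw [hx2] at hS
      generalize σ x = y at *
      generalize σ α = b at *
      have hA := congrArg₂ (fun u v => u ^ 2 + u * v + v ^ 2) key key'
      linear_combination -2 * hA - 6 * (k₁ ^ 2 + k₁ * k₂ + k₂ ^ 2) * hform + 81 * hS
    have h2 := mul_left_cancel₀ (by norm_num) h1
    exact_mod_cast h2
  -- as `3 ∤ P`, this forces `k₁ ≡ k₂` modulo `3`, which removes the factor `3` from `key`
  have h3 : 3 ∣ (k₁ - k₂) ^ 2 := by
    have h1 : 3 ∣ P * (k₁ ^ 2 + k₁ * k₂ + k₂ ^ 2) :=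
      ⟨P * (k₁ ^ 2 + k₁ * k₂ + k₂ ^ 2) - (3 * S - τ ^ 2), by linarith⟩
    obtain ⟨y, hy⟩ := (hp.dvd_or_dvd h1).resolve_left hα.not_three_dvd
    exact ⟨y - k₁ * k₂, by linear_combination hy⟩
  obtain ⟨r, hr⟩ := hp.dvd_of_dvd_pow h3
  obtain rfl : k₁ = k₂ + 3 * r := by omega
  refine ⟨τ, k₂ + 2 * r, k₂ + r, S, hτ, ?_, by linarith, hS⟩
  refine mul_left_cancel₀ (three_ne_zero (α := K)) ?_
  push_cast at key ⊢
  linear_combination key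

/-- The trace of every integer is divisible by `3`: otherwise `α` would be congruent to a rational
integer `s` prime to `3` modulo `3`, and the norm of `α - s` would give `27 ∣ 4 P³ - q²`. -/
theorem three_dvd_trace (hσ : IsCubicGenerator σ) (hα : IsTraceZeroGenerator σ α P q)
    {x : K} (hx : IsIntegral ℤ x) {τ : ℤ} (hτ : x + σ x + σ (σ x) = τ) : 3 ∣ τ := by
  by_contra h3
  obtain ⟨τ', i, j, S, hτ', hij, hS, -⟩ := hα.exists_three_mul_eq hσ hx
  obtain rfl : τ = τ' := by exact_mod_cast (hτ.symm.trans hτ')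
  -- squares prime to `3` are `1` modulo `3`
  have hsq : ∀ z : ℤ, ¬ 3 ∣ z → ∃ w, z ^ 2 = 3 * w + 1 := by
    intro z hz
    obtain ⟨w, rfl | rfl⟩ : ∃ w, z = 3 * w + 1 ∨ z = 3 * w + 2 := ⟨z / 3, by omega⟩
    · exact ⟨3 * w ^ 2 + 2 * w, by ring⟩
    · exact ⟨3 * w ^ 2 + 4 * w + 1, by ring⟩
  obtain ⟨w, hw⟩ := hsq τ h3
  have hij3 : ¬ 3 ∣ i + j := by
    rintro ⟨y, hy⟩
    have : τ ^ 2 = 3 * (S - 2 * P * (3 * y ^ 2 - i * j)) := by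
      linear_combination hS - 2 * P * (i + j + 3 * y) * hy
    omega
  obtain ⟨v, hv⟩ := hsq _ hij3
  -- the quadratic form takes the value `1` modulo `3`, which forces `P ≡ 1` modulo `3`
  have hN : i ^ 2 - i * j + j ^ 2 = 3 * (v - i * j) + 1 := by linear_combination hv
  have hP1 : ∃ y, P = 3 * y + 1 := by
    refine ⟨P + 2 * P * (v - i * j) - S + w, ?_⟩
    linear_combination -hS + hw + 2 * P * hN
  obtain ⟨u, hu⟩ := hP1
  -- applying `i + j σ²` to `3 x - τ = i α + j σ(α)` gives `(i² - i j + j²) α`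
  set s : ℤ := -τ * (i + j) with hs
  obtain ⟨y, hy, hys⟩ : ∃ y : K, IsIntegral ℤ y ∧ α = 3 * y + s := by
    refine ⟨i * x + j * σ (σ x) - (v - i * j : ℤ) * α, ?_, ?_⟩
    · exact (((isIntegral_intCast _).mul hx).add
        ((isIntegral_intCast _).mul ((hx.apply_gal σ).apply_gal σ))).sub
        ((isIntegral_intCast _).mul hα.isIntegral)
    · have h2 := congrArg (fun z => σ (σ z)) hij
      simp only [map_sub, map_add, map_mul, map_intCast, map_ofNat, hσ.apply_three] at h2
      have hN' : ((i ^ 2 - i * j + j ^ 2 : ℤ) : K) = (3 * (v - i * j) + 1 : ℤ) := by rw [hN]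
      push_cast [hs] at hN' ⊢
      linear_combination (-i : K) * hij - j * h2 - i * j * hα.trace - α * hN'
  -- the norm of `3 y = α - s` is divisible by `27`
  obtain ⟨f, hf⟩ : 27 ∣ q + 3 * P * s - s ^ 3 := by
    refine dvd_of_mul_isIntegral (K := K) (by norm_num)
      ((hy.mul (hy.apply_gal σ)).mul ((hy.apply_gal σ).apply_gal σ)) ?_
    have h1 : σ α = 3 * σ y + s := by rw [hys, map_add, map_mul, map_ofNat, map_intCast]
    have h2 : σ (σ α) = 3 * σ (σ y) + s := by rw [h1, map_add, map_mul, map_ofNat, map_intCast]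
    push_cast
    have e0 : 3 * y = α - s := by linear_combination -hys
    have e1 : 3 * σ y = σ α - s := by linear_combination -h1
    have e2 : 3 * σ (σ y) = σ (σ α) - s := by linear_combination -h2
    have : (27 : K) * (y * σ y * σ (σ y)) = (α - s) * (σ α - s) * (σ (σ α) - s) := by
      rw [← e0, ← e1, ← e2]; ring
    rw [this]
    linear_combination -hα.norm - s * hα.form + (s * (α + σ α) - s ^ 2) * hα.trace
  have hs3 : ¬ 3 ∣ s := fun h => (Int.prime_three.dvd_or_dvd h).elim
    (fun h => h3 ((dvd_neg).1 h)) hij3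
  obtain ⟨g, hg⟩ := hsq s hs3
  -- modulo `27`, `4 P³ - q²` is `-(s² - P)² (s² - 4 P)`
  apply hα.not_dvd
  have hq : q = s ^ 3 - 3 * P * s + 27 * f := by linarith
  refine ⟨-(g - u) ^ 2 * (g - 4 * u - 1) - f * (2 * (s ^ 3 - 3 * P * s) + 27 * f), ?_⟩
  have : 4 * P ^ 3 - q ^ 2 = -(s ^ 2 - P) ^ 2 * (s ^ 2 - 4 * P)
      - 27 * f * (2 * (s ^ 3 - 3 * P * s) + 27 * f) := by rw [hq]; ring
  rw [this, hg, hu]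
  ring

/-- The integers are spanned over `ℤ` by `α`, `σ(α)` and `1`. -/
theorem exists_eq (hσ : IsCubicGenerator σ) (hα : IsTraceZeroGenerator σ α P q)
    {x : K} (hx : IsIntegral ℤ x) : ∃ i j k : ℤ, x = i * α + j * σ α + k := by
  have hp := Int.prime_three
  obtain ⟨τ, i, j, S, hτ, hij, hN, hS⟩ := hα.exists_three_mul_eq hσ hx
  obtain ⟨k, rfl⟩ := hα.three_dvd_trace hσ hx hτ
  -- the traces of `x` and `x²` are divisible by `3`, hence `9 ∣ i² - i j + j²`
  obtain ⟨S', rfl⟩ : 3 ∣ S := by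
    refine hα.three_dvd_trace hσ (hx.pow 2) ?_
    simpa using hS
  have h9 : (3 : ℤ) ^ 2 ∣ i ^ 2 - i * j + j ^ 2 := by
    refine hp.pow_dvd_of_dvd_mul_left 2 (a := 2 * P) ?_ ⟨S' - k ^ 2, by rw [hN]; ring⟩
    have := hα.not_three_dvd
    omega
  obtain ⟨y, hy⟩ := h9
  obtain ⟨r, hr⟩ : 3 ∣ i + j :=
    hp.dvd_of_dvd_pow (n := 2) ⟨3 * y + i * j, by linear_combination hy⟩
  have h3 : 3 ∣ i * j := ⟨r ^ 2 - y, mul_left_cancel₀ (three_ne_zero (α := ℤ)) (by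
    linear_combination (i + j + 3 * r) * hr - hy)⟩
  obtain ⟨i', rfl⟩ : 3 ∣ i := by
    rcases hp.dvd_or_dvd h3 with h | h <;> omega
  obtain ⟨j', rfl⟩ : 3 ∣ j := by omega
  refine ⟨i', j', k, mul_left_cancel₀ (three_ne_zero (α := K)) ?_⟩
  push_cast at hij
  linear_combination hij

end IsTraceZeroGenerator

end CyclicCubic

/-! ### The simplest cubic field as a cyclic cubic field -/

theorem shanksCubic_natDegree (n : ℤ) : (shanksCubic n).natDegree = 3 := by
  unfold shanksCubic; compute_degree!

theorem shanksCubic_monic (n : ℤ) : (shanksCubic n).Monic := by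
  unfold shanksCubic; monicity!

theorem shanksCubic_irreducible (n : ℤ) : Irreducible (shanksCubic n) := by
  rw [(shanksCubic_monic n).irreducible_iff_roots_eq_zero_of_degree_le_three
    (by rw [shanksCubic_natDegree]; norm_num) (by rw [shanksCubic_natDegree])]
  refine Multiset.eq_zero_of_forall_notMem fun x hx => ?_
  have hx0 : x * (x ^ 2 - n * x - (n + 3)) = 1 := by
    have h := (mem_roots'.1 hx).2
    simp only [shanksCubic, IsRoot.def, eval_sub, eval_mul, eval_pow, eval_X, eval_C,
      eval_one] at h
    linear_combination h
  rcases Int.isUnit_iff.1 (IsUnit.of_mul_eq_one _ hx0) with rfl | rfl <;> omega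

theorem shanksCubic_root_eq {F : Type*} [Field F] {n : ℤ} {ρ : F}
    (hρ : aeval ρ (shanksCubic n) = 0) :
    ρ ^ 3 - n * ρ ^ 2 - (n + 3) * ρ - 1 = 0 := by
  simp only [shanksCubic, map_sub, map_mul, map_pow, aeval_X, aeval_C, map_one] at hρ
  simpa using hρ

section SimplestCubic

variable {K : Type*} [Field K] [NumberField K] {n : ℤ} {ρ : K}

theorem minpoly_eq_shanksCubic (hρ : aeval ρ (shanksCubic n) = 0) :
    minpoly ℚ ρ = (shanksCubic n).map (algebraMap ℤ ℚ) := by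
  refine (minpoly.eq_of_irreducible_of_monic ?_ ?_ ((shanksCubic_monic n).map _)).symm
  · exact ((shanksCubic_monic n).irreducible_iff_irreducible_map_fraction_map).1
      (shanksCubic_irreducible n)
  · rw [aeval_map_algebraMap, hρ]

theorem one_add_root_ne_zero (hρ : aeval ρ (shanksCubic n) = 0) : 1 + ρ ≠ 0 := by
  intro h
  obtain rfl : ρ = -1 := by linear_combination h
  have := shanksCubic_root_eq hρ
  ring_nf at this
  exact one_ne_zero this

/-- The field has an automorphism `ρ ↦ -1 / (1 + ρ)`; being of order three, the degree of the
field, it generates the Galois group. -/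
theorem exists_isCubicGenerator (hρ : aeval ρ (shanksCubic n) = 0)
    (hK : IntermediateField.adjoin ℚ {ρ} = ⊤) :
    ∃ σ : Gal(K/ℚ), σ ρ = -1 / (1 + ρ) ∧ Subgroup.zpowers σ = ⊤ ∧ IsCubicGenerator σ := by
  have hmin := minpoly_eq_shanksCubic hρ
  have h1ρ := one_add_root_ne_zero hρ
  have heq := shanksCubic_root_eq hρ
  have hint : IsIntegral ℚ ρ := Algebra.IsIntegral.isIntegral ρ
  have hdeg : Module.finrank ℚ K = 3 := by
    rw [← IntermediateField.finrank_top', ← hK, IntermediateField.adjoin.finrank hint, hmin,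
      (shanksCubic_monic n).natDegree_map, shanksCubic_natDegree]
  have hadj : Algebra.adjoin ℚ {ρ} = ⊤ := by
    rw [← IntermediateField.adjoin_simple_toSubalgebra_of_isAlgebraic hint.isAlgebraic, hK,
      IntermediateField.top_toSubalgebra]
  let pb : PowerBasis ℚ K := PowerBasis.ofAdjoinEqTop hint hadj
  have hgen : pb.gen = ρ := PowerBasis.ofAdjoinEqTop_gen hint hadj
  have hroot : aeval (-1 / (1 + ρ)) (minpoly ℚ pb.gen) = 0 := by
    rw [hgen, hmin, aeval_map_algebraMap]
    simp only [shanksCubic, map_sub, map_mul, map_pow, aeval_X, aeval_C, map_one]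
    simp
    field_simp
    linear_combination -heq
  let φ : K →ₐ[ℚ] K := pb.lift _ hroot
  let σ : Gal(K/ℚ) := AlgEquiv.ofBijective φ (Algebra.IsAlgebraic.algHom_bijective φ)
  have hσ : σ ρ = -1 / (1 + ρ) := by
    have := pb.lift_gen _ hroot
    rw [hgen] at this
    exact this
  have hρ0 : ρ ≠ 0 := by
    rintro rfl
    simp at heq
  have hσ2 : σ (σ ρ) = -(1 + ρ) / ρ := by
    have : (1 + ρ + -1 : K) ≠ 0 := by simpa using hρ0
    rw [hσ]
    simp only [map_div₀, map_neg, map_one, map_add, hσ]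
    field_simp
    ring
  have hσ3 : σ (σ (σ ρ)) = ρ := by
    rw [hσ2]
    simp only [map_div₀, map_neg, map_one, map_add, hσ]
    field_simp
    ring
  have hcube : σ ^ 3 = 1 := by
    apply AlgEquiv.coe_toAlgHom_injective
    apply pb.algHom_ext
    rw [hgen]
    exact hσ3
  have hne : σ ≠ 1 := by
    intro h
    have h1 : σ ρ = ρ := by rw [h]; rfl
    rw [hσ, div_eq_iff h1ρ] at h1
    have h2 : aeval ρ (X ^ 2 + X + 1 : ℚ[X]) = 0 := by
      simp
      linear_combination -h1
    have h3 := natDegree_le_of_dvd (minpoly.dvd ℚ ρ h2) (by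
      intro h
      have := congrArg (eval 0) h
      simp at this)
    rw [hmin, (shanksCubic_monic n).natDegree_map, shanksCubic_natDegree] at h3
    have h4 : (X ^ 2 + X + 1 : ℚ[X]).natDegree = 2 := by compute_degree!
    omega
  have horder : orderOf σ = 3 := by
    have : Fact (Nat.Prime 3) := ⟨Nat.prime_three⟩
    exact orderOf_eq_prime hcube hne
  have hcard : Nat.card Gal(K/ℚ) = 3 := by
    refine le_antisymm ?_ ?_
    · rw [Nat.card_eq_fintype_card, ← hdeg]
      exact AlgEquiv.card_le
    · rw [← horder]
      exact orderOf_le_card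
  have htop : Subgroup.zpowers σ = ⊤ := by
    rw [← Subgroup.card_eq_iff_eq_top, Nat.card_zpowers, horder, hcard]
  have : IsGalois ℚ K := IsGalois.of_card_aut_eq_finrank ℚ K (by rw [hcard, hdeg])
  refine ⟨σ, hσ, htop, fun x => ?_, fun x => ?_⟩
  · exact DFunLike.congr_fun hcube x
  · have h1 := trace_eq_sum_automorphisms (K := ℚ) x
    have h2 : ∑ τ : Gal(K/ℚ), τ x = x + σ x + σ (σ x) := by
      classical
      have hall : ∀ τ, τ ∈ Subgroup.zpowers σ := fun τ => htop ▸ Subgroup.mem_top τ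
      rw [← IsCyclic.image_range_orderOf hall, horder, Finset.sum_image]
      · simp [Finset.sum_range_succ]
      · intro i hi j hj hij
        refine pow_injOn_Iio_orderOf ?_ ?_ hij <;> simp_all
    rw [h1, h2]

/-- The product of the conjugates of `a₀ (ρ - m) + a₁ (ρ' - m)`, for `n = 3 m`. -/
theorem prod_conj_eq {F : Type*} [CommRing F] {r s u m : F} (a₀ a₁ t : F)
    (h0 : r + s + u = 3 * m) (h1 : r * s = -1 - s) (h2 : s * u = -1 - u) (h3 : u * r = -1 - r)
    (ht : t = a₀ - a₁ * (m + 1)) :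
    (a₀ * (r - m) + a₁ * (s - m)) * (a₀ * (s - m) + a₁ * (u - m)) *
      (a₀ * (u - m) + a₁ * (r - m)) =
    (m ^ 2 + m + 1) * ((2 * m + 1) * t ^ 3 + 6 * t ^ 2 * a₁ * (m ^ 2 + m + 1) +
        3 * t * a₁ ^ 2 * (m ^ 2 + m + 1) * (2 * m + 1) +
        a₁ ^ 3 * (m ^ 2 + m + 1) * (2 * m ^ 2 + 2 * m - 1)) := by
  have e2 : r * s + s * u + u * r = -3 - 3 * m := by linear_combination h1 + h2 + h3 - h0
  have e3 : r * s * u = 1 := by linear_combination u * h1 - h2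
  have eA : r ^ 2 * s + s ^ 2 * u + u ^ 2 * r = 3 := by
    linear_combination (r - 1) * h1 + (s - 1) * h2 + (u - 1) * h3
  have eB : r * s ^ 2 + s * u ^ 2 + u * r ^ 2 = -9 * m ^ 2 - 9 * m - 6 := by
    linear_combination s * h1 + u * h2 + r * h3 - (r + s + u + 3 * m + 1) * h0 + 2 * e2
  have eQ : r ^ 2 + s ^ 2 + u ^ 2 = 9 * m ^ 2 + 6 + 6 * m := by
    linear_combination (r + s + u + 3 * m) * h0 - 2 * e2
  subst ht
  linear_combination (a₀ ^ 3 + a₁ ^ 3) * e3 + a₀ ^ 2 * a₁ * eA + a₀ * a₁ ^ 2 * eB -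
    m * (a₀ ^ 3 + 2 * a₀ ^ 2 * a₁ + 2 * a₀ * a₁ ^ 2 + a₁ ^ 3) * e2 -
    m * a₀ * a₁ * (a₀ + a₁) * eQ + m ^ 2 * (a₀ + a₁) ^ 3 * h0

end SimplestCubic

/-! ### The Galois module structure of the ring of integers -/

namespace GaloisModule

variable {K : Type*} [Field K] [NumberField K]

theorem single_mem_integralGroupRing (τ : Gal(K/ℚ)) (k : ℤ) :
    MonoidAlgebra.single τ (k : ℚ) ∈ integralGroupRing K :=
  ⟨MonoidAlgebra.single τ k, by simp⟩

theorem act_single (τ : Gal(K/ℚ)) (q : ℚ) (a : K) :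
    act K (MonoidAlgebra.single τ q) a = q * τ a := by
  simp [act, MonoidAlgebra.lift_single, Rat.smul_def]

theorem integralGroupRing_le_associatedOrder : integralGroupRing K ≤ associatedOrder K := by
  rintro _ ⟨y, rfl⟩ a ha
  rw [act_apply]
  refine sum_mem fun τ _ => ?_
  have : ((MonoidAlgebra.mapRingHom Gal(K/ℚ) (Int.castRingHom ℚ)) y).coeff τ =
      (y.coeff τ : ℚ) := by simp
  rw [this, Rat.smul_def, Rat.cast_intCast]
  exact (isIntegral_intCast _).mul (IsIntegral.apply_gal ha τ)

variable {σ : Gal(K/ℚ)} {α : K} {P q : ℤ}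

theorem integers_eq_sup (hσ : IsCubicGenerator σ) (hα : IsTraceZeroGenerator σ α P q) :
    integers K = cyclicModule (integralGroupRing K) α ⊔ (Int.castAddHom K).range := by
  refine le_antisymm (fun x hx => ?_) (sup_le ?_ ?_)
  · obtain ⟨i, j, k, rfl⟩ := hα.exists_eq hσ hx
    refine AddSubgroup.add_mem_sup ⟨_, add_mem (single_mem_integralGroupRing 1 i)
      (single_mem_integralGroupRing σ j), ?_⟩ ⟨k, rfl⟩
    change act K _ α = _
    rw [map_add, LinearMap.add_apply, act_single, act_single]
    simp
  · rintro _ ⟨y, hy, rfl⟩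
    exact integralGroupRing_le_associatedOrder hy α hα.isIntegral
  · rintro _ ⟨k, rfl⟩
    exact isIntegral_intCast k

/-- The elements of `ℤ[G] . α` have trace zero, the non-zero integers have not. -/
theorem disjoint_cyclicModule (hσ : IsCubicGenerator σ) (hα : IsTraceZeroGenerator σ α P q) :
    Disjoint (cyclicModule (integralGroupRing K) α) (Int.castAddHom K).range := by
  rw [AddSubgroup.disjoint_def]
  rintro _ ⟨y, -, rfl⟩ ⟨k, hk⟩
  change (k : K) = act K y α at hk
  change act K y α = 0
  have h0 : Algebra.trace ℚ K α = 0 := by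
    have h := hσ.trace_eq α
    rw [hα.trace] at h
    exact (map_eq_zero _).1 h
  have h1 : Algebra.trace ℚ K (act K y α) = 0 := by
    rw [act_apply, map_sum]
    refine Finset.sum_eq_zero fun τ _ => ?_
    rw [map_smul, Algebra.trace_eq_of_algEquiv, h0, smul_zero]
  have h2 := hσ.trace_eq (act K y α)
  rw [h1, ← hk] at h2
  simp only [map_zero, map_intCast] at h2
  rw [← hk]
  have : (3 : K) * k = 0 := by linear_combination -h2
  simpa using this

/-- Since traces of integers are divisible by `3`, the idempotent `(1 + σ + σ²) / 3` lies in the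
associated order; it separates `α` and `1` in `α + 1`. -/
theorem integers_eq_cyclicModule_associatedOrder (hσ : IsCubicGenerator σ)
    (hα : IsTraceZeroGenerator σ α P q) :
    integers K = cyclicModule (associatedOrder K) (α + 1) := by
  refine le_antisymm (fun x hx => ?_) ?_
  · set ε : MonoidAlgebra ℚ Gal(K/ℚ) := MonoidAlgebra.single 1 (1 / 3) +
      MonoidAlgebra.single σ (1 / 3) + MonoidAlgebra.single (σ * σ) (1 / 3) with hε
    have hεa : ∀ a, act K ε a = (a + σ a + σ (σ a)) / 3 := by
      intro a
      simp only [hε, map_add, LinearMap.add_apply, act_single, AlgEquiv.one_apply,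
        AlgEquiv.mul_apply]
      push_cast
      ring
    have hεmem : ε ∈ associatedOrder K := by
      intro a ha
      obtain ⟨τ, hτ⟩ := hσ.trace_int ha
      obtain ⟨k, rfl⟩ := hα.three_dvd_trace hσ ha hτ
      have : act K ε a = (k : K) := by
        rw [hεa, hτ]; push_cast; field_simp
      rw [this]
      exact isIntegral_intCast k
    obtain ⟨i, j, k, rfl⟩ := hα.exists_eq hσ hx
    have hmem : ∀ τ : Gal(K/ℚ), ∀ l : ℤ, MonoidAlgebra.single τ (l : ℚ) ∈ associatedOrder K :=
      fun τ l => integralGroupRing_le_associatedOrder (single_mem_integralGroupRing τ l)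
    have hy : (MonoidAlgebra.single 1 (i : ℚ) + MonoidAlgebra.single σ (j : ℚ)) * (1 - ε) +
        MonoidAlgebra.single 1 (k : ℚ) * ε ∈ associatedOrder K :=
      add_mem (mul_mem (add_mem (hmem _ _) (hmem _ _)) (sub_mem (one_mem _) hεmem))
        (mul_mem (hmem _ _) hεmem)
    refine ⟨_, hy, ?_⟩
    change act K _ (α + 1) = _
    have h1 : act K ε (α + 1) = 1 := by
      rw [hεa]
      simp only [map_add, map_one]
      rw [div_eq_iff three_ne_zero]
      linear_combination hα.trace
    simp only [map_add (act K), map_mul (act K), map_sub (act K), map_one (act K),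
      LinearMap.add_apply, Module.End.mul_apply, LinearMap.sub_apply, Module.End.one_apply, h1,
      act_single]
    simp
  · rintro _ ⟨y, hy, rfl⟩
    exact hy _ (hα.isIntegral.add isIntegral_one)

end GaloisModule

/-- The element `α` of the theorem has trace zero, and its characteristic polynomial is read off
from the norm form of `a₀ + a₁ ζ` and from `prod_conj_eq`. -/
theorem isTraceZeroGenerator_of_params {K : Type*} [Field K] [NumberField K] {σ : Gal(K/ℚ)}
    (hσ : IsCubicGenerator σ) {ρ α : K} {m a₀ a₁ w P q : ℤ}
    (hρ : aeval ρ (shanksCubic (3 * m)) = 0) (hσρ : σ ρ = -1 / (1 + ρ)) (hw : w ≠ 0)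
    (hα : w * α = 3 * (a₀ * (ρ - m) + a₁ * (σ ρ - m)))
    (h : IsCubicParams m a₀ a₁ w P q) :
    IsTraceZeroGenerator σ α P q := by
  have hw' : (w : K) ≠ 0 := by exact_mod_cast hw
  have heq := shanksCubic_root_eq hρ
  push_cast at heq
  have h1ρ := one_add_root_ne_zero hρ
  have h1 : ρ * σ ρ = -1 - σ ρ := by
    rw [hσρ]; field_simp; ring
  have h2 : σ ρ * σ (σ ρ) = -1 - σ (σ ρ) := by simpa using congrArg σ h1
  have h3 : σ (σ ρ) * ρ = -1 - ρ := by
    have := congrArg σ h2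
    simpa [hσ.apply_three] using this
  have hρ0 : ρ ≠ 0 := by
    rintro rfl
    simp at heq
  have h0 : ρ + σ ρ + σ (σ ρ) = 3 * m := by
    have e : σ (σ ρ) = (-1 - ρ) / ρ := by rw [eq_div_iff hρ0]; exact h3
    rw [e, hσρ]
    field_simp
    linear_combination heq
  have hα1 : w * σ α = 3 * (a₀ * (σ ρ - m) + a₁ * (σ (σ ρ) - m)) := by
    simpa [-mul_eq_mul_left_iff, map_ofNat] using congrArg σ hα
  have hα2 : w * σ (σ α) = 3 * (a₀ * (σ (σ ρ) - m) + a₁ * (ρ - m)) := by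
    simpa [-mul_eq_mul_left_iff, map_ofNat, hσ.apply_three] using congrArg σ hα1
  have htrace : α + σ α + σ (σ α) = 0 := by
    refine mul_left_cancel₀ hw' ?_
    linear_combination hα + hα1 + hα2 + 3 * (a₀ + a₁) * h0
  have hform' : α ^ 2 + α * σ α + σ α ^ 2 = 3 * P := by
    refine mul_left_cancel₀ (pow_ne_zero 2 hw') ?_
    have hf := congrArg (Int.cast : ℤ → K) h.form
    push_cast at hf
    have e2 : ρ * σ ρ + σ ρ * σ (σ ρ) + σ (σ ρ) * ρ = -3 - 3 * m := by
      linear_combination h1 + h2 + h3 - h0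
    have : (w : K) ^ 2 * (α ^ 2 + α * σ α + σ α ^ 2) =
      (w * α) ^ 2 + (w * α) * (w * σ α) + (w * σ α) ^ 2 := by ring
    rw [this, hα, hα1]
    have hu : σ (σ ρ) = 3 * m - ρ - σ ρ := by linear_combination h0
    rw [hu] at e2 ⊢
    linear_combination 3 * hf - 9 * (a₀ ^ 2 - a₀ * a₁ + a₁ ^ 2) * e2
  have hnorm' : α * σ α * σ (σ α) = q := by
    refine mul_left_cancel₀ (pow_ne_zero 3 hw') ?_
    have hn := congrArg (Int.cast : ℤ → K) h.norm
    push_cast at hn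
    have hprod := prod_conj_eq (a₀ : K) a₁ _ h0 h1 h2 h3 rfl
    have : (w : K) ^ 3 * (α * σ α * σ (σ α)) = (w * α) * (w * σ α) * (w * σ (σ α)) := by ring
    rw [this, hα, hα1, hα2]
    linear_combination 27 * hprod + hn
  refine ⟨?_, htrace, hnorm', hform', h.squarefree, h.not_three_dvd, h.dvd, h.not_dvd⟩
  refine ⟨X ^ 3 - C (3 * P) * X - C q, by monicity!, ?_⟩
  simp only [eval₂_sub, eval₂_mul, eval₂_pow, eval₂_X, eval₂_C, algebraMap_int_eq,
    Int.coe_castRingHom]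
  push_cast
  linear_combination α * hform' + hnorm' - α * σ α * htrace

theorem theorem4p1
    (n : ℤ) (hn3 : 3 ∣ n) (hn12 : ¬ n ≡ 12 [ZMOD 27])
    -- the simplest cubic field `K = ℚ(ρ)`
    (K : Type*) [Field K] [NumberField K] (ρ : K)
    (hρ : aeval ρ (shanksCubic n) = 0)
    (hK : IntermediateField.adjoin ℚ {ρ} = ⊤)
    -- the decomposition `n² + 3n + 9 = d e² c³`
    (d e c : ℕ) (hd0 : 0 < d) (he0 : 0 < e) (hc0 : 0 < c)
    (hd : Squarefree d) (he : Squarefree e) (hde : Nat.Coprime d e)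
    (hΔ : n ^ 2 + 3 * n + 9 = (d : ℤ) * (e : ℤ) ^ 2 * (c : ℤ) ^ 3)
    (ζ : ℂ) (hζ : IsPrimitiveRoot ζ 3)
    (a₀ a₁ : ℤ)
    (h3 : n ≡ 3 [ZMOD 9] → (e : ℤ) * (c : ℤ) = a₀ ^ 2 - a₀ * a₁ + a₁ ^ 2)
    (h06 : n ≡ 0 [ZMOD 9] ∨ n ≡ 6 [ZMOD 9] →
      (e : ℤ) * (c : ℤ) = 3 * (a₀ ^ 2 - a₀ * a₁ + a₁ ^ 2))
    -- `a₀ + a₁ ζ` divides `A_n = n + 3 (1 + ζ)` in the ring `ℤ[ζ]`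
    (hdvd : (a₀ : Algebra.adjoin ℤ {ζ}) + (a₁ : Algebra.adjoin ℤ {ζ}) * adjoinGen ζ ∣
      (n : Algebra.adjoin ℤ {ζ}) + 3 * (1 + adjoinGen ζ)) :
    ∃ σ : Gal(K/ℚ), σ ρ = -1 / (1 + ρ) ∧ Subgroup.zpowers σ = ⊤ ∧
      ∃ α : K,
        α = (3 * (a₀ : K) * ρ + 3 * (a₁ : K) * σ ρ - (n : K) * ((a₀ : K) + (a₁ : K))) /
          ((e : K) * (c : K) ^ 2) ∧
        -- `𝓞 = ℤ[G] . α ⊕ ℤ`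
        GaloisModule.integers K =
          GaloisModule.cyclicModule (GaloisModule.integralGroupRing K) α ⊔
            (Int.castAddHom K).range ∧
        Disjoint (GaloisModule.cyclicModule (GaloisModule.integralGroupRing K) α)
          (Int.castAddHom K).range ∧
        -- `𝓞 = 𝒜 . (α + 1)`
        GaloisModule.integers K =
          GaloisModule.cyclicModule (GaloisModule.associatedOrder K) (α + 1) := by
  obtain ⟨m, rfl⟩ := hn3
  obtain ⟨σ, hσρ, htop, hσ⟩ := exists_isCubicGenerator hρ hK
  have hdvd' : a₀ ^ 2 - a₀ * a₁ + a₁ ^ 2 ∣ 3 * (a₀ - a₁ * (m + 1)) := by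
    convert norm_dvd_of_dvd_adjoin hζ hdvd using 1
    ring
  have hΔ' : 9 * (m ^ 2 + m + 1) = (d : ℤ) * (e : ℤ) ^ 2 * (c : ℤ) ^ 3 := by
    rw [← hΔ]; ring
  have hd' : Squarefree (d : ℤ) := Int.squarefree_natCast.2 hd
  have he' : Squarefree (e : ℤ) := Int.squarefree_natCast.2 he
  have hde' : IsCoprime (d : ℤ) e := Nat.isCoprime_iff_coprime.2 hde
  obtain ⟨P, q, hPq⟩ : ∃ P q : ℤ, IsCubicParams m a₀ a₁ ((e : ℤ) * (c : ℤ) ^ 2) P q := by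
    unfold Int.ModEq at hn12 h3 h06
    by_cases hm : m ≡ 1 [ZMOD 3]
    · refine exists_params_of_modEq_one hm ?_ hd' he' hde' hΔ' (h3 ?_) hdvd' <;>
        unfold Int.ModEq at * <;> omega
    · refine exists_params_of_not_modEq_one hm hd' he' hde' hΔ' (h06 ?_) hdvd'
      unfold Int.ModEq at hm
      omega
  have hw : (e : ℤ) * (c : ℤ) ^ 2 ≠ 0 := by positivity
  have hwK : (e : K) * (c : K) ^ 2 ≠ 0 := by exact_mod_cast hw
  have hα := isTraceZeroGenerator_of_params hσ (α := (3 * (a₀ : K) * ρ + 3 * (a₁ : K) * σ ρ -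
    ((3 * m : ℤ) : K) * ((a₀ : K) + (a₁ : K))) / ((e : K) * (c : K) ^ 2)) hρ hσρ hw
    (by push_cast; rw [mul_div_cancel₀ _ hwK]; ring) hPq
  exact ⟨σ, hσρ, htop, _, rfl, GaloisModule.integers_eq_sup hσ hα,
    GaloisModule.disjoint_cyclicModule hσ hα,
    GaloisModule.integers_eq_cyclicModule_associatedOrder hσ hα⟩
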